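/- Let $K$ be an algebraically closed field of characteristic $p \ge 3$, and let $(\mathfrak{u},[p])$ be a finite-dimensional restricted Lie algebra over $K$ which is unipotent, i.e. there is $n \ge 0$ such that $x^{[p]^n} = 0$ for all $x \in \mathfrak{u}$, where $x^{[p]^n}$ is the result of applying the $p$-map $n$ times to $x$. Let $\mathrm{Gr}_2(\mathfrak{u})$ be the Grassmannian of two-dimensional subspaces of $\mathfrak{u}$, with its Zariski topology (induced by the Plücker embedding into $\mathbb{P}(\bigwedge^2 \mathfrak{u})$), and let $$\mathbb{E}(2,\mathfrak{u}) = \{\mathfrak{e} \in \mathrm{Gr}_2(\mathfrak{u}) : [\mathfrak{e},\mathfrak{e}] = 0 \text{ and } x^{[p]} = 0 \text{ for all } x \in \mathfrak{e}\}$$ be the set of two-dimensional elementary abelian $p$-subalgebras of $\mathfrak{u}$. Then $\mathbb{E}(2,\mathfrak{u})$, with the subspace topology, is connected (the empty set counts as connected). -/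

import Mathlib

open scoped TensorProduct

noncomputable section

namespace RestrictedLie

section PMaps

variable (p : ℕ) (K L : Type*) [Field K] [LieRing L] [LieAlgebra K L]

/-- The linear map `K[T] ⊗ L → L` that sends `x₀ ⊗ 1 + x₁ ⊗ T + x₂ ⊗ T² + ⋯` to `xₙ`. -/
def coeffMap (n : ℕ) : Polynomial K ⊗[K] L →ₗ[K] L :=
  (TensorProduct.lid K L).toLinearMap ∘ₗ (Polynomial.lcoeff K n).rTensor L

variable {L}

/-- The terms `sᵢ(x, y)` (`1 ≤ i ≤ p - 1`) of Jacobson's formula. They are determined by the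
equation `ad (x ⊗ T + y ⊗ 1) ^ (p - 1) (x ⊗ 1) = ∑ᵢ i • sᵢ(x, y) ⊗ T ^ (i - 1)`
in the Lie algebra `K[T] ⊗ L` over `K[T]`, where `K` has characteristic `p`. -/
def jacobsonTerm (i : ℕ) (x y : L) : L :=
  (i : K)⁻¹ • coeffMap K L (i - 1)
    (((LieAlgebra.ad (Polynomial K) (Polynomial K ⊗[K] L)
        (Polynomial.X ⊗ₜ[K] x + 1 ⊗ₜ[K] y)) ^ (p - 1)) (1 ⊗ₜ[K] x))

variable (L)

/-- A `p`-map `x ↦ x^[p]` on a Lie algebra `L` over a field `K` of characteristic `p`; the pair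
consisting of `L` and a `p`-map on `L` is a restricted Lie algebra. -/
structure PMap where
  /-- the underlying map `x ↦ x^[p]` -/
  toFun : L → L
  ad_toFun : ∀ x : L, LieAlgebra.ad K L (toFun x) = (LieAlgebra.ad K L x) ^ p
  toFun_smul : ∀ (a : K) (x : L), toFun (a • x) = a ^ p • toFun x
  toFun_add : ∀ x y : L,
    toFun (x + y) = toFun x + toFun y + ∑ i ∈ Finset.Icc 1 (p - 1), jacobsonTerm p K i x y

variable {p K L}

/-- `(L, [p])` is unipotent (`[p]`-nilpotent) if some iterate of the `p`-map is zero on `L`. -/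
def PMap.IsUnipotent (P : PMap p K L) : Prop :=
  ∃ n : ℕ, ∀ x : L, P.toFun^[n] x = 0

end PMaps

section Zariski

open scoped LinearAlgebra.Projectivization

variable (K V : Type*) [Field K] [AddCommGroup V] [Module K V]

variable {K V} in
/-- The value at `v` of a polynomial in linear forms on `V`. (On a finite-dimensional space these
are the polynomial functions in the coordinates of any basis.) -/
def evalAt (f : MvPolynomial (Module.Dual K V) K) (v : V) : K :=
  MvPolynomial.eval (fun φ : Module.Dual K V => φ v) f

variable {K V} in
theorem evalAt_smul {f : MvPolynomial (Module.Dual K V) K} {n : ℕ} (hf : f.IsHomogeneous n)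
    (a : K) (v : V) : evalAt f (a • v) = a ^ n * evalAt f v := by
  unfold evalAt
  rw [MvPolynomial.eval_eq, MvPolynomial.eval_eq, Finset.mul_sum]
  refine Finset.sum_congr rfl fun d hd => ?_
  have hd' : ∑ i ∈ d.support, d i = n := by
    have := hf (MvPolynomial.mem_support_iff.mp hd)
    rw [Finsupp.weight_apply] at this
    simpa [Finsupp.sum] using this
  simp only [map_smul, smul_eq_mul, mul_pow, Finset.prod_mul_distrib, Finset.prod_pow_eq_pow_sum,
    hd']
  ring

variable {K V} in
/-- The set of points of the projective space of `V` at which the homogeneous polynomial `f`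
does not vanish. -/
def basicOpen (f : MvPolynomial (Module.Dual K V) K) : Set (ℙ K V) :=
  {P | evalAt f P.rep ≠ 0}

variable {K V} in
/-- Non-vanishing of a homogeneous polynomial does not depend on the representative. -/
theorem mk_mem_basicOpen {f : MvPolynomial (Module.Dual K V) K} {n : ℕ} (hf : f.IsHomogeneous n)
    (v : V) (hv : v ≠ 0) : Projectivization.mk K v hv ∈ basicOpen f ↔ evalAt f v ≠ 0 := by
  obtain ⟨a, ha⟩ := Projectivization.exists_smul_eq_mk_rep K v hv
  change evalAt f _ ≠ 0 ↔ _
  rw [← ha, Units.smul_def, evalAt_smul hf]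
  simp

/-- The Zariski topology on the projective space of `V`: the closed sets are the common zero sets
of families of homogeneous polynomials. -/
@[reducible]
def projZariski : TopologicalSpace (ℙ K V) :=
  TopologicalSpace.generateFrom
    {U | ∃ (n : ℕ) (f : MvPolynomial (Module.Dual K V) K), f.IsHomogeneous n ∧ U = basicOpen f}

/-- The Grassmannian of two-dimensional subspaces of `V`. -/
def Gr₂ : Type _ := {W : Submodule K V // Module.finrank K W = 2}

variable {K V}

theorem wedge_ne_zero {v : Fin 2 → V} (hv : LinearIndependent K v) :
    exteriorPower.ιMulti K 2 v ≠ 0 := by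
  have h := (exteriorPower.ιMulti_family_linearIndependent_field 2 hv).ne_zero
    (Set.powersetCard.ofFinEmbEquiv (RelEmbedding.refl (· ≤ ·) : Fin 2 ↪o Fin 2))
  simpa [exteriorPower.ιMulti_family] using h

/-- A basis of a two-dimensional subspace. -/
def Gr₂.basis (W : Gr₂ K V) : Module.Basis (Fin 2) K W.1 :=
  haveI : Module.Finite K W.1 := Module.finite_of_finrank_eq_succ W.2
  Module.finBasisOfFinrankEq K W.1 W.2

theorem Gr₂.basis_linearIndependent (W : Gr₂ K V) :
    LinearIndependent K (fun i => (W.basis i : V)) :=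
  W.basis.linearIndependent.map' W.1.subtype W.1.ker_subtype

/-- The Plücker embedding of the Grassmannian of two-dimensional subspaces: the subspace with
basis `w₀, w₁` goes to the line spanned by `w₀ ∧ w₁` in the exterior square of `V`. -/
def plucker (W : Gr₂ K V) : ℙ K (⋀[K]^2 V) :=
  Projectivization.mk K (exteriorPower.ιMulti K 2 fun i => (W.basis i : V))
    (wedge_ne_zero W.basis_linearIndependent)

/-- The Plücker point of a subspace can be computed from any of its bases. -/
theorem plucker_eq (W : Gr₂ K V) (v : Fin 2 → V) (hv : LinearIndependent K v)
    (hW : ∀ i, v i ∈ W.1) :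
    plucker W = Projectivization.mk K (exteriorPower.ιMulti K 2 v) (wedge_ne_zero hv) := by
  have hne := wedge_ne_zero hv
  have hexp : ∀ i, v i = W.basis.repr ⟨v i, hW i⟩ 0 • (W.basis 0 : V)
      + W.basis.repr ⟨v i, hW i⟩ 1 • (W.basis 1 : V) := by
    intro i
    have h := congrArg W.1.subtype (W.basis.sum_repr ⟨v i, hW i⟩)
    rw [Fin.sum_univ_two] at h
    exact h.symm
  have key : ∀ (a b c d : K) (x y : V),
      exteriorPower.ιMulti K 2 ![a • x + b • y, c • x + d • y]
        = (a * d - b * c) • exteriorPower.ιMulti K 2 ![x, y] := by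
    intro a b c d x y
    apply Subtype.ext
    have hyx : ExteriorAlgebra.ι K y * ExteriorAlgebra.ι K x
        = -(ExteriorAlgebra.ι K x * ExteriorAlgebra.ι K y) :=
      eq_neg_of_add_eq_zero_left (ExteriorAlgebra.ι_add_mul_swap y x)
    simp only [exteriorPower.ιMulti_apply_coe, ExteriorAlgebra.ιMulti_apply, Submodule.coe_smul]
    simp [mul_add, add_mul, hyx, smul_smul, sub_smul, mul_comm]
    abel
  have hvec : ∀ u : Fin 2 → V, u = ![u 0, u 1] := fun u => by
    ext i; fin_cases i <;> rfl
  have hE : exteriorPower.ιMulti K 2 v =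
      (W.basis.repr ⟨v 0, hW 0⟩ 0 * W.basis.repr ⟨v 1, hW 1⟩ 1
        - W.basis.repr ⟨v 0, hW 0⟩ 1 * W.basis.repr ⟨v 1, hW 1⟩ 0) •
      exteriorPower.ιMulti K 2 ![(W.basis 0 : V), (W.basis 1 : V)] := by
    rw [← key, ← hexp 0, ← hexp 1, ← hvec v]
  unfold plucker
  rw [Projectivization.mk_eq_mk_iff', hvec (fun i => (W.basis i : V))]
  refine ⟨(W.basis.repr ⟨v 0, hW 0⟩ 0 * W.basis.repr ⟨v 1, hW 1⟩ 1
    - W.basis.repr ⟨v 0, hW 0⟩ 1 * W.basis.repr ⟨v 1, hW 1⟩ 0)⁻¹, ?_⟩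
  rw [hE] at hne ⊢
  rw [smul_smul, inv_mul_cancel₀ (left_ne_zero_of_smul hne), one_smul]

/-- The Zariski topology on the Grassmannian of two-dimensional subspaces, induced by the
Plücker embedding. -/
instance Gr₂.instTopologicalSpace : TopologicalSpace (Gr₂ K V) :=
  TopologicalSpace.induced plucker (projZariski K (⋀[K]^2 V))

end Zariski

/-- The set `𝔼(2, L)` of two-dimensional elementary abelian `p`-subalgebras of `(L, [p])`: the
two-dimensional subspaces `e` with `[e, e] = 0` and `e^[p] = 0`. -/
def elemAb₂ {p : ℕ} {K L : Type*} [Field K] [LieRing L] [LieAlgebra K L] (P : PMap p K L) :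
    Set (Gr₂ K L) :=
  {e | (∀ x ∈ e.1, ∀ y ∈ e.1, ⁅x, y⁆ = 0) ∧ ∀ x ∈ e.1, P.toFun x = 0}

end RestrictedLie

end

/-! Unipotence and Engel's theorem give a central z ≠ 0 with z^[p] = 0. If e ∈ 𝔼(2, u) has basis v,
y and misses z, the pencil of planes ⟨v, sy + tz⟩ links e to ⟨v, z⟩ inside 𝔼(2, u)
(`exists_linked_mem`). A plane through z is ⟨z, x⟩ with x^[p] = 0 and x ∉ Kz, so it remains to join
all such x, up to Kz, by curves of such elements.

`PMap.exists_curves` does this for pairs of ideals J ≤ I, by induction on growing I; the case needed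
is J = 0, I = Kz. Choose b ∉ I with [L, b] ⊆ I and b^[p] ∈ I. Jacobson's terms for x and ab are
combinations of brackets of length p ≥ 3, hence lie in [L, I] ⊆ J, so (x + ab)^[p] ≡ x^[p] + a^p
b^[p] mod J. If b^[p] ∈ J, straight lines to b suffice. Otherwise b^[p] spans I/J, and the pair I ≤
I + Kb provides curves γ with γ^[p] ∈ I. Adding qb cancels the component of γ^[p] in I/J; here q
must be a p-th root, which is polynomial once (s, t) is replaced by (s^p, t^p).

Homogeneous curves in (s, t) parametrize families over the projective line, which is covered by two
affine charts. On each chart the Plücker coordinates are polynomial in one variable, and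
connectedness follows because K is infinite. -/

open scoped TensorProduct

noncomputable section

namespace RestrictedLie

/-! ### Homogeneous polynomial curves -/

section Curves

variable (K M : Type*) [Field K] [AddCommGroup M] [Module K M]

/-- The homogeneous polynomial maps `K × K → M` of degree `d`. -/
def homCurve (d : ℕ) : Submodule K (K × K → M) :=
  Submodule.span K {g | ∃ i j : ℕ, i + j = d ∧ ∃ m : M, g = fun st => (st.1 ^ i * st.2 ^ j) • m}

variable {K M}

theorem monomial_mem_homCurve {d : ℕ} (i j : ℕ) (h : i + j = d) (m : M) :
    (fun st : K × K => (st.1 ^ i * st.2 ^ j) • m) ∈ homCurve K M d :=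
  Submodule.subset_span ⟨i, j, h, m, rfl⟩

theorem linear_mem_homCurve (x y : M) :
    (fun st : K × K => st.1 • x + st.2 • y) ∈ homCurve K M 1 := by
  have h := add_mem (monomial_mem_homCurve (K := K) (d := 1) 1 0 rfl x)
    (monomial_mem_homCurve (K := K) (d := 1) 0 1 rfl y)
  simpa [Pi.add_def] using h

theorem homCurve_map {N : Type*} [AddCommGroup N] [Module K N] (φ : M →ₗ[K] N) {d : ℕ}
    {g : K × K → M} (hg : g ∈ homCurve K M d) : (fun st => φ (g st)) ∈ homCurve K N d := by
  induction hg using Submodule.span_induction with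
  | mem g hg =>
    obtain ⟨i, j, h, m, rfl⟩ := hg
    simpa using monomial_mem_homCurve i j h (φ m)
  | zero => simp only [Pi.zero_apply, map_zero]; exact zero_mem _
  | add g g' _ _ hg hg' => simpa [Pi.add_def] using add_mem hg hg'
  | smul a g _ hg => simpa [Pi.smul_def] using Submodule.smul_mem _ a hg

theorem homCurve_bilin {N R : Type*} [AddCommGroup N] [Module K N] [AddCommGroup R] [Module K R]
    (B : M →ₗ[K] N →ₗ[K] R) {d e : ℕ} {g : K × K → M} (hg : g ∈ homCurve K M d)
    {f : K × K → N} (hf : f ∈ homCurve K N e) :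
    (fun st => B (g st) (f st)) ∈ homCurve K R (d + e) := by
  induction hg using Submodule.span_induction with
  | mem g hg =>
    obtain ⟨i, j, h, m, rfl⟩ := hg
    induction hf using Submodule.span_induction with
    | mem f hf =>
      obtain ⟨i', j', h', n, rfl⟩ := hf
      convert monomial_mem_homCurve (K := K) (d := d + e) (i + i') (j + j') (by omega) (B m n)
        using 2 with st
      simp only [map_smul, LinearMap.smul_apply, smul_smul]
      congr 1
      ring
    | zero => simp only [Pi.zero_apply, map_zero]; exact zero_mem _
    | add g g' _ _ hg hg' => simp only [Pi.add_apply, map_add]; exact add_mem hg hg'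
    | smul a g _ hg =>
      simp only [Pi.smul_apply, (B _).map_smul]; exact Submodule.smul_mem _ a hg
  | zero => simp only [Pi.zero_apply, map_zero, LinearMap.zero_apply]; exact zero_mem _
  | add g g' _ _ hg hg' =>
    simp only [Pi.add_apply, map_add, LinearMap.add_apply]; exact add_mem hg hg'
  | smul a g _ hg =>
    simp only [Pi.smul_apply, map_smul, LinearMap.smul_apply]; exact Submodule.smul_mem _ a hg

theorem homCurve_comp_pow (p : ℕ) {d : ℕ} {g : K × K → M} (hg : g ∈ homCurve K M d) :
    (fun st => g (st.1 ^ p, st.2 ^ p)) ∈ homCurve K M (p * d) := by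
  induction hg using Submodule.span_induction with
  | mem g hg =>
    obtain ⟨i, j, h, m, rfl⟩ := hg
    simpa [← pow_mul] using monomial_mem_homCurve (K := K) (d := p * d) (p * i) (p * j)
      (by rw [← h]; ring) m
  | zero => exact zero_mem (homCurve K M (p * d))
  | add g g' _ _ hg hg' => exact add_mem hg hg'
  | smul a g _ hg => exact Submodule.smul_mem _ a hg

/-- Frobenius is additive, so it suffices to take p-th roots of the coefficients and keep the
exponents. The root therefore has the degree of h itself. -/
theorem exists_pow_root [IsAlgClosed K] (p : ℕ) [CharP K p] [Fact p.Prime] {d : ℕ}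
    {h : K × K → K} (hh : h ∈ homCurve K K d) :
    ∃ q ∈ homCurve K K d, ∀ st, q st ^ p = h (st.1 ^ p, st.2 ^ p) := by
  have hp : 0 < p := (Fact.out : p.Prime).pos
  induction hh using Submodule.span_induction with
  | mem g hg =>
    obtain ⟨i, j, h, m, rfl⟩ := hg
    obtain ⟨r, hr⟩ := IsAlgClosed.exists_pow_nat_eq m hp
    refine ⟨_, monomial_mem_homCurve i j h r, fun st => ?_⟩
    simp only [smul_eq_mul, mul_pow, hr, ← pow_mul, mul_comm]
  | zero => exact ⟨0, zero_mem _, fun st => by simp [hp.ne']⟩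
  | add g g' _ _ hg hg' =>
    obtain ⟨q, hq, h⟩ := hg
    obtain ⟨q', hq', h'⟩ := hg'
    exact ⟨q + q', add_mem hq hq', fun st => by simp [add_pow_char, h, h']⟩
  | smul a g _ hg =>
    obtain ⟨q, hq, h⟩ := hg
    obtain ⟨r, hr⟩ := IsAlgClosed.exists_pow_nat_eq a hp
    exact ⟨r • q, Submodule.smul_mem _ r hq, fun st => by simp [mul_pow, h, hr]⟩

theorem homCurve_eval_left {d : ℕ} {g : K × K → K} (hg : g ∈ homCurve K K d) :
    ∃ Q : Polynomial K, ∀ t, g (1, t) = Q.eval t := by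
  induction hg using Submodule.span_induction with
  | mem g hg =>
    obtain ⟨i, j, h, m, rfl⟩ := hg
    exact ⟨Polynomial.C m * Polynomial.X ^ j, fun t => by simp [mul_comm m]⟩
  | zero => exact ⟨0, fun t => by simp⟩
  | add g g' _ _ hg hg' =>
    obtain ⟨Q, h⟩ := hg
    obtain ⟨Q', h'⟩ := hg'
    exact ⟨Q + Q', fun t => by simp [h, h']⟩
  | smul a g _ hg =>
    obtain ⟨Q, h⟩ := hg
    exact ⟨a • Q, fun t => by simp [h]⟩

theorem homCurve_comp_swap {d : ℕ} {g : K × K → M} (hg : g ∈ homCurve K M d) :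
    (fun st => g st.swap) ∈ homCurve K M d := by
  induction hg using Submodule.span_induction with
  | mem g hg =>
    obtain ⟨i, j, h, m, rfl⟩ := hg
    simpa [mul_comm] using monomial_mem_homCurve (K := K) j i (by omega) m
  | zero => exact zero_mem (homCurve K M d)
  | add g g' _ _ hg hg' => exact add_mem hg hg'
  | smul a g _ hg => exact Submodule.smul_mem _ a hg

end Curves

/-! ### Jacobson's formula and central elements modulo a subspace -/

section Jacobson

variable {K L : Type*} [Field K] [LieRing L] [LieAlgebra K L]

theorem coeffMap_tmul (n : ℕ) (f : Polynomial K) (l : L) :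
    coeffMap K L n (f ⊗ₜ[K] l) = f.coeff n • l := by
  simp [coeffMap]

theorem coeffMap_one_tmul (n : ℕ) (l : L) :
    coeffMap K L n (1 ⊗ₜ[K] l) = if n = 0 then l else 0 := by
  rw [coeffMap_tmul, Polynomial.coeff_one]
  split_ifs <;> simp

/-- Together with `coeffMap_ad_succ`, a recursion on coefficients that reduces statements about
Jacobson's terms to brackets in L. -/
theorem coeffMap_ad_zero (x y : L) (m : Polynomial K ⊗[K] L) :
    coeffMap K L 0 (LieAlgebra.ad (Polynomial K) (Polynomial K ⊗[K] L)
      (Polynomial.X ⊗ₜ[K] x + 1 ⊗ₜ[K] y) m) = ⁅y, coeffMap K L 0 m⁆ := by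
  induction m using TensorProduct.induction_on with
  | zero => simp
  | tmul f l =>
    rw [LieAlgebra.ad_apply, add_lie, LieAlgebra.ExtendScalars.bracket_tmul,
      LieAlgebra.ExtendScalars.bracket_tmul, map_add]
    simp [coeffMap_tmul]
  | add m m' h h' => rw [map_add, map_add, h, h', map_add, lie_add]

theorem coeffMap_ad_succ (n : ℕ) (x y : L) (m : Polynomial K ⊗[K] L) :
    coeffMap K L (n + 1) (LieAlgebra.ad (Polynomial K) (Polynomial K ⊗[K] L)
      (Polynomial.X ⊗ₜ[K] x + 1 ⊗ₜ[K] y) m)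
      = ⁅x, coeffMap K L n m⁆ + ⁅y, coeffMap K L (n + 1) m⁆ := by
  induction m using TensorProduct.induction_on with
  | zero => simp
  | tmul f l =>
    rw [LieAlgebra.ad_apply, add_lie, LieAlgebra.ExtendScalars.bracket_tmul,
      LieAlgebra.ExtendScalars.bracket_tmul, map_add]
    simp [coeffMap_tmul]
  | add m m' h h' =>
    rw [map_add, map_add, h, h', map_add, map_add, lie_add, lie_add]
    abel

theorem coeffMap_ad_mem {A B : Submodule K L} {x y : L} (hx : ∀ a ∈ A, ⁅x, a⁆ ∈ B)
    (hy : ∀ a ∈ A, ⁅y, a⁆ ∈ B) {m : Polynomial K ⊗[K] L} (hm : ∀ n, coeffMap K L n m ∈ A)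
    (n : ℕ) : coeffMap K L n (LieAlgebra.ad (Polynomial K) (Polynomial K ⊗[K] L)
      (Polynomial.X ⊗ₜ[K] x + 1 ⊗ₜ[K] y) m) ∈ B := by
  cases n with
  | zero => rw [coeffMap_ad_zero]; exact hy _ (hm 0)
  | succ n => rw [coeffMap_ad_succ]; exact add_mem (hx _ (hm n)) (hy _ (hm (n + 1)))

/-- Of the p - 1 ≥ 2 applications of ad(xT + y) to x, the first gives coefficients in K[x, y], the
second moves them into J, and J absorbs the rest. -/
theorem jacobsonTerm_mem {p : ℕ} (hp : 3 ≤ p) {J : Submodule K L}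
    (hJ : ∀ x : L, ∀ y ∈ J, ⁅x, y⁆ ∈ J) {x y : L} (hx : ⁅x, ⁅x, y⁆⁆ ∈ J) (hy : ⁅y, ⁅x, y⁆⁆ ∈ J)
    (i : ℕ) : jacobsonTerm p K i x y ∈ J := by
  refine Submodule.smul_mem _ _ ?_
  suffices h : ∀ k n, coeffMap K L n (((LieAlgebra.ad (Polynomial K) (Polynomial K ⊗[K] L)
      (Polynomial.X ⊗ₜ[K] x + 1 ⊗ₜ[K] y)) ^ (k + 2)) (1 ⊗ₜ[K] x)) ∈ J by
    obtain ⟨k, rfl⟩ := Nat.exists_eq_add_of_le hp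
    rw [show 3 + k - 1 = k + 2 by omega]
    exact h k (i - 1)
  intro k
  induction k with
  | zero =>
    rw [zero_add, pow_two]
    simp only [Module.End.mul_apply]
    have h1 : ∀ n, coeffMap K L n (LieAlgebra.ad (Polynomial K) (Polynomial K ⊗[K] L)
        (Polynomial.X ⊗ₜ[K] x + 1 ⊗ₜ[K] y) (1 ⊗ₜ[K] x)) ∈ Submodule.span K {⁅x, y⁆} := by
      refine coeffMap_ad_mem (A := Submodule.span K {x}) ?_ ?_ fun n => ?_
      · intro a ha
        obtain ⟨c, rfl⟩ := Submodule.mem_span_singleton.mp ha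
        simp
      · intro a ha
        obtain ⟨c, rfl⟩ := Submodule.mem_span_singleton.mp ha
        rw [lie_smul, ← neg_neg ⁅y, x⁆, lie_skew]
        exact Submodule.smul_mem _ _ (neg_mem (Submodule.mem_span_singleton_self _))
      · rw [coeffMap_one_tmul]
        split_ifs
        · exact Submodule.mem_span_singleton_self _
        · exact zero_mem _
    have h2 : ∀ v : L, ⁅v, ⁅x, y⁆⁆ ∈ J → ∀ a ∈ Submodule.span K {⁅x, y⁆}, ⁅v, a⁆ ∈ J := by
      intro v hv a ha
      obtain ⟨c, rfl⟩ := Submodule.mem_span_singleton.mp ha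
      rw [lie_smul]
      exact Submodule.smul_mem _ _ hv
    exact coeffMap_ad_mem (h2 x hx) (h2 y hy) h1
  | succ k ih =>
    rw [show k + 1 + 2 = (k + 2) + 1 from rfl, pow_succ']
    simp only [Module.End.mul_apply]
    exact coeffMap_ad_mem (hJ x) (hJ y) ih

theorem homCurve_lie {d e : ℕ} {g : K × K → L} (hg : g ∈ homCurve K L d)
    {f : K × K → L} (hf : f ∈ homCurve K L e) :
    (fun st => ⁅g st, f st⁆) ∈ homCurve K L (d + e) :=
  homCurve_bilin (LieModule.toEnd K L L : L →ₗ[K] Module.End K L) hg hf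

theorem coeffMap_ad_pow_homCurve {d : ℕ} {g f : K × K → L} (hg : g ∈ homCurve K L d)
    (hf : f ∈ homCurve K L d) (k : ℕ) : ∀ n, (fun st => coeffMap K L n
      (((LieAlgebra.ad (Polynomial K) (Polynomial K ⊗[K] L)
        (Polynomial.X ⊗ₜ[K] (g st) + 1 ⊗ₜ[K] (f st))) ^ k) (1 ⊗ₜ[K] (g st))))
      ∈ homCurve K L ((k + 1) * d) := by
  induction k with
  | zero =>
    intro n
    simp only [pow_zero, Module.End.one_apply, coeffMap_one_tmul]
    split_ifs
    · simpa using hg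
    · exact zero_mem _
  | succ k ih =>
    have e : (k + 1 + 1) * d = d + (k + 1) * d := by ring
    intro n
    simp only [pow_succ', Module.End.mul_apply]
    rw [e]
    cases n with
    | zero =>
      simp only [coeffMap_ad_zero]
      exact homCurve_lie hf (ih 0)
    | succ n =>
      simp only [coeffMap_ad_succ]
      exact add_mem (homCurve_lie hg (ih n)) (homCurve_lie hf (ih (n + 1)))

namespace PMap

variable {p : ℕ} (P : PMap p K L)

theorem toFun_zero (hp : 0 < p) : P.toFun 0 = 0 := by
  simpa [hp.ne'] using P.toFun_smul 0 0

/-- Jacobson's terms are combinations of p-fold brackets, so the p-map is a homogeneous polynomial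
map of degree p. -/
theorem toFun_homCurve (hp : 0 < p) {d : ℕ} {g : K × K → L} (hg : g ∈ homCurve K L d) :
    (fun st => P.toFun (g st)) ∈ homCurve K L (p * d) := by
  induction hg using Submodule.span_induction with
  | mem g hg =>
    obtain ⟨i, j, h, m, rfl⟩ := hg
    simp only [P.toFun_smul, mul_pow, ← pow_mul]
    exact monomial_mem_homCurve (i * p) (j * p) (by rw [← h]; ring) _
  | zero =>
    simp only [Pi.zero_apply, P.toFun_zero hp]
    exact zero_mem _
  | add g f hg0 hf0 hg hf =>
    simp only [Pi.add_apply, P.toFun_add]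
    refine add_mem (add_mem hg hf) ?_
    have h : ∀ i, (fun st => jacobsonTerm p K i (g st) (f st)) ∈ homCurve K L (p * d) := by
      intro i
      have := coeffMap_ad_pow_homCurve hg0 hf0 (p - 1) (i - 1)
      rw [Nat.sub_add_cancel hp] at this
      exact Submodule.smul_mem _ _ this
    convert sum_mem (t := Finset.Icc 1 (p - 1)) fun i _ => h i using 1
    ext st
    simp
  | smul a g _ hg =>
    simp only [Pi.smul_apply, P.toFun_smul]
    exact Submodule.smul_mem _ _ hg

theorem toFun_add_sub_mem (hp : 3 ≤ p) {J : Submodule K L}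
    (hJ : ∀ x : L, ∀ y ∈ J, ⁅x, y⁆ ∈ J) {x y : L} (hx : ⁅x, ⁅x, y⁆⁆ ∈ J) (hy : ⁅y, ⁅x, y⁆⁆ ∈ J) :
    P.toFun (x + y) - (P.toFun x + P.toFun y) ∈ J := by
  rw [P.toFun_add, add_sub_cancel_left]
  exact sum_mem fun i _ => jacobsonTerm_mem hp hJ hx hy i

/-- Iterating the p-map on x raises ad x to p-power exponents, so every ad x is nilpotent and
Engel's theorem applies. -/
theorem isNilpotent [FiniteDimensional K L] (hP : P.IsUnipotent) : LieRing.IsNilpotent L := by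
  rw [LieAlgebra.isNilpotent_iff_forall (R := K)]
  intro x
  obtain ⟨n, hn⟩ := hP
  have h : ∀ k, LieAlgebra.ad K L (P.toFun^[k] x) = LieAlgebra.ad K L x ^ p ^ k := by
    intro k
    induction k with
    | zero => simp
    | succ k ih => rw [Function.iterate_succ_apply', P.ad_toFun, ih, pow_succ, pow_mul]
  exact ⟨p ^ n, by rw [← h, hn, map_zero]⟩

/-- A proper subspace `I` has an element `b` outside it with `[L, b] ⊆ I` and `b^[p] ∈ I`. -/
theorem exists_central_mod (hp : 0 < p) [FiniteDimensional K L] (hP : P.IsUnipotent)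
    {I : Submodule K L} (htop : I ≠ ⊤) :
    ∃ b ∉ I, (∀ x : L, ⁅x, b⁆ ∈ I) ∧ P.toFun b ∈ I := by
  classical
  have := P.isNilpotent hP
  have hex : ∃ k, (LieModule.lowerCentralSeries K L L k).toSubmodule ≤ I := by
    obtain ⟨k, hk⟩ := (LieModule.isNilpotent_iff K L L).mp inferInstance
    exact ⟨k, by rw [hk]; simp⟩
  -- Take b₀ in the last term of the lower central series not contained in I.
  obtain ⟨b₀, hb₀, hb₀'⟩ : ∃ b ∉ I, ∀ x : L, ⁅x, b⁆ ∈ I := by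
    have h1 := Nat.find_spec hex
    have h2 : Nat.find hex ≠ 0 := by
      intro h
      rw [h] at h1
      exact htop (top_le_iff.mp (by simpa using h1))
    obtain ⟨k, hk⟩ := Nat.exists_eq_succ_of_ne_zero h2
    have h3 := Nat.find_min hex (m := k) (by omega)
    rw [SetLike.not_le_iff_exists] at h3
    obtain ⟨b, hb, hbI⟩ := h3
    refine ⟨b, hbI, fun x => h1 ?_⟩
    rw [hk, Nat.succ_eq_add_one, LieModule.lowerCentralSeries_succ]
    exact LieSubmodule.lie_mem_lie (LieSubmodule.mem_top x) hb
  -- The outermost bracket in (ad b)^p x is with b, so the property passes from b to b^[p]. The last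
  -- iterate outside I is then the required element.
  have hc : ∀ k, ∀ x : L, ⁅x, P.toFun^[k] b₀⁆ ∈ I := by
    intro k
    induction k with
    | zero => exact hb₀'
    | succ k ih =>
      intro x
      rw [Function.iterate_succ_apply', ← lie_skew, ← LieAlgebra.ad_apply K, P.ad_toFun]
      refine neg_mem ?_
      have : ∀ m, ((LieAlgebra.ad K L (P.toFun^[k] b₀)) ^ (m + 1)) x ∈ I := by
        intro m
        rw [pow_succ', Module.End.mul_apply, LieAlgebra.ad_apply, ← lie_skew]
        exact neg_mem (ih _)
      obtain ⟨m, rfl⟩ := Nat.exists_eq_succ_of_ne_zero hp.ne'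
      exact this m
  have hex' : ∃ k, P.toFun^[k] b₀ ∈ I := by
    obtain ⟨n, hn⟩ := hP
    exact ⟨n, by rw [hn]; exact zero_mem _⟩
  have h1 := Nat.find_spec hex'
  have h2 : Nat.find hex' ≠ 0 := by
    intro h
    rw [h] at h1
    exact hb₀ h1
  obtain ⟨k, hk⟩ := Nat.exists_eq_succ_of_ne_zero h2
  refine ⟨P.toFun^[k] b₀, Nat.find_min hex' (by omega), hc k, ?_⟩
  rw [← Function.iterate_succ_apply' P.toFun, ← hk]
  exact h1

end PMap

end Jacobson

/-! ### Lifting curves through the p-map -/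

section Correction

theorem mem_sup_span_singleton {K M : Type*} [Field K] [AddCommGroup M] [Module K M]
    {I : Submodule K M} {b y : M} :
    y ∈ I ⊔ Submodule.span K {b} ↔ ∃ i ∈ I, ∃ a : K, i + a • b = y := by
  simp [Submodule.mem_sup, Submodule.mem_span_singleton]

variable {K L : Type*} [Field K] [IsAlgClosed K] [LieRing L] [LieAlgebra K L]
  [FiniteDimensional K L]

/-- Let `J ≤ I` be ideals with `[L, I] ≤ J` and `I^[p] ⊆ J`, of codimension at most one. All
elements outside `I` of the preimage of `J` under the `p`-map can be joined, up to `I`, to one and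
the same element by homogeneous curves that stay in this preimage and outside `I`. -/
theorem PMap.exists_curves {p : ℕ} [CharP K p] (hp : 3 ≤ p) (P : PMap p K L)
    (hP : P.IsUnipotent) (I : Submodule K L) :
    ∀ (J : Submodule K L) (φ : Module.Dual K L), J ≤ I → (∀ v ∈ J, φ v = 0) →
      (∀ v ∈ I, φ v = 0 → v ∈ J) → (∀ x : L, ∀ y ∈ J, ⁅x, y⁆ ∈ J) →
      (∀ x : L, ∀ y ∈ I, ⁅x, y⁆ ∈ J) → (∀ y ∈ I, P.toFun y ∈ J) →
    ∃ w, P.toFun w ∈ J ∧ ∀ x, P.toFun x ∈ J → x ∉ I → x ∈ I ⊔ Submodule.span K {w} ∨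
      ∃ d, ∃ γ ∈ homCurve K L d, γ (1, 0) = x ∧ γ (0, 1) = w ∧
        ∀ st ≠ 0, P.toFun (γ st) ∈ J ∧ γ st ∉ I := by
  have : Fact p.Prime :=
    ⟨(CharP.char_is_prime_or_zero K p).resolve_right (by omega)⟩
  have hp0 : 0 < p := by omega
  induction I using WellFoundedGT.induction with
  | ind I ih =>
  intro J φ hJI hφJ hφI hJ hI hIp
  by_cases htop : I = ⊤
  · exact ⟨0, by rw [P.toFun_zero hp0]; exact zero_mem _, fun x _ hx => by simp [htop] at hx⟩
  have hadd : ∀ c : L, (∀ x : L, ⁅x, c⁆ ∈ I) → ∀ x : L,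
      P.toFun (x + c) - (P.toFun x + P.toFun c) ∈ J := fun c hc x =>
    P.toFun_add_sub_mem hp hJ (hI _ _ (hc x)) (hI _ _ (hc x))
  obtain ⟨b, hbI, hbad, hbp⟩ := P.exists_central_mod hp0 hP htop
  -- Here w = b: the segment sx + tb avoids I unless x ∈ I + Kb.
  by_cases hbJ : P.toFun b ∈ J
  · refine ⟨b, hbJ, fun x hx hxI => or_iff_not_imp_left.mpr fun hxb => ?_⟩
    refine ⟨1, _, linear_mem_homCurve x b, by simp, by simp, fun st hst => ⟨?_, fun hmem => ?_⟩⟩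
    · have h := hadd (st.2 • b) (fun x => by rw [lie_smul]; exact I.smul_mem _ (hbad x))
        (st.1 • x)
      rw [P.toFun_smul, P.toFun_smul] at h
      exact (Submodule.sub_mem_iff_left _
        (add_mem (J.smul_mem _ hx) (J.smul_mem _ hbJ))).mp h
    · by_cases hs : st.1 = 0
      · have ht : st.2 ≠ 0 := fun ht => hst (Prod.ext hs ht)
        rw [hs, zero_smul, zero_add, Submodule.smul_mem_iff _ ht] at hmem
        exact hbI hmem
      · refine hxb (mem_sup_span_singleton.mpr ⟨_, I.smul_mem st.1⁻¹ hmem, -(st.1⁻¹ * st.2), ?_⟩)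
        rw [smul_add, smul_smul, smul_smul, inv_mul_cancel₀ hs, one_smul, neg_smul,
          add_neg_cancel_right]
  obtain ⟨b, hbI, hbad, hbp, hφb⟩ : ∃ b ∉ I, (∀ x : L, ⁅x, b⁆ ∈ I) ∧ P.toFun b ∈ I ∧
      φ (P.toFun b) = 1 := by
    have hc : φ (P.toFun b) ≠ 0 := fun h => hbJ (hφI _ hbp h)
    obtain ⟨a, ha⟩ := IsAlgClosed.exists_pow_nat_eq (φ (P.toFun b))⁻¹ hp0
    have ha0 : a ≠ 0 := by
      rintro rfl
      rw [zero_pow hp0.ne'] at ha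
      exact inv_ne_zero hc ha.symm
    refine ⟨a • b, fun h => hbI ((Submodule.smul_mem_iff _ ha0).mp h), fun x => ?_, ?_, ?_⟩
    · rw [lie_smul]
      exact I.smul_mem _ (hbad x)
    · rw [P.toFun_smul]
      exact I.smul_mem _ hbp
    · rw [P.toFun_smul, map_smul, ha, smul_eq_mul, inv_mul_cancel₀ hc]
  have haddb : ∀ (x : L) (a : K),
      P.toFun (x + a • b) - (P.toFun x + a ^ p • P.toFun b) ∈ J := fun x a => by
    rw [← P.toFun_smul]
    exact hadd _ (fun x => by rw [lie_smul]; exact I.smul_mem _ (hbad x)) x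
  -- An element whose p-th power lies in I is corrected by a multiple of b; `hzero` says that this
  -- multiple is unique.
  have hcorr : ∀ (v : L) (a : K), P.toFun v ∈ I → a ^ p = -φ (P.toFun v) → P.toFun (v + a • b) ∈ J := by
    intro v a hv ha
    refine (Submodule.sub_mem_iff_left _ (hφI _ (add_mem hv (I.smul_mem _ hbp)) ?_)).mp (haddb v a)
    rw [map_add, map_smul, hφb, ha, smul_eq_mul, mul_one, add_neg_cancel]
  have hzero : ∀ (v : L) (a : K), P.toFun v ∈ J → P.toFun (v + a • b) ∈ J → a = 0 := by
    intro v a hv ha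
    have h := (Submodule.sub_mem_iff_right _ ha).mp (haddb v a)
    have h' := hφJ _ ((Submodule.add_mem_iff_right _ hv).mp h)
    rw [map_smul, hφb, smul_eq_mul, mul_one] at h'
    exact pow_eq_zero_iff hp0.ne' |>.mp h'
  have hbI' : b ∈ I ⊔ Submodule.span K {b} :=
    Submodule.mem_sup_right (Submodule.mem_span_singleton_self b)
  obtain ⟨ψ, hψb, hψ⟩ := Submodule.exists_le_ker_of_notMem hbI
  obtain ⟨w, hw, H⟩ := ih (I ⊔ Submodule.span K {b})
    (lt_of_le_of_ne le_sup_left fun h => hbI (h ▸ hbI')) I ψ le_sup_left (fun v hv => hψ hv)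
    (by
      intro v hv hv0
      obtain ⟨i, hi, a, rfl⟩ := mem_sup_span_singleton.mp hv
      rw [map_add, show ψ i = 0 from hψ hi, zero_add, map_smul, smul_eq_mul] at hv0
      rw [(mul_eq_zero.mp hv0).resolve_right hψb, zero_smul, add_zero]
      exact hi)
    (fun x y hy => hJI (hI x y hy))
    (by
      intro x y hy
      obtain ⟨i, hi, a, rfl⟩ := mem_sup_span_singleton.mp hy
      rw [lie_add, lie_smul]
      exact add_mem (hJI (hI x i hi)) (I.smul_mem _ (hbad x)))
    (by
      intro y hy
      obtain ⟨i, hi, a, rfl⟩ := mem_sup_span_singleton.mp hy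
      exact (Submodule.sub_mem_iff_left _
        (add_mem (hJI (hIp i hi)) (I.smul_mem _ hbp))).mp (hJI (haddb i a)))
  -- The end point of the larger pair only has its p-th power in I, so it needs a correction too.
  obtain ⟨μ, hμ⟩ := IsAlgClosed.exists_pow_nat_eq (-φ (P.toFun w)) hp0
  have hwJ := hcorr w μ hw hμ
  refine ⟨w + μ • b, hwJ, fun x hx hxI => ?_⟩
  have hxI' : x ∉ I ⊔ Submodule.span K {b} := by
    intro hmem
    obtain ⟨i, hi, a, rfl⟩ := mem_sup_span_singleton.mp hmem
    rw [hzero i a (hIp i hi) hx, zero_smul, add_zero] at hxI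
    exact hxI hi
  rcases H x (hJI hx) hxI' with hmem | ⟨d, γ, hγ, hγx, hγw, hγJ⟩
  · left
    obtain ⟨y, hy, ν, rfl⟩ := mem_sup_span_singleton.mp hmem
    obtain ⟨i, hi, β, rfl⟩ := mem_sup_span_singleton.mp hy
    have e : i + β • b + ν • w = (ν • (w + μ • b) + i) + (β - ν * μ) • b := by module
    have h1 : P.toFun (ν • (w + μ • b) + i) ∈ J := by
      refine (Submodule.sub_mem_iff_left _ (add_mem ?_ (hIp i hi))).mp
        (hadd i (fun x => hJI (hI x i hi)) _)
      rw [P.toFun_smul]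
      exact J.smul_mem _ hwJ
    rw [e] at hx ⊢
    rw [hzero _ _ h1 hx, zero_smul, add_zero]
    exact mem_sup_span_singleton.mpr ⟨i, hi, ν, add_comm _ _⟩
  · right
    have hinj : ∀ {a c : K}, a ^ p = c ^ p → a = c := fun h => frobenius_inj K p h
    -- Both q and γ(s^p, t^p) have degree pd, so γ(s^p, t^p) + q(s, t)b is again homogeneous. At (1,
    -- 0) the correction vanishes; at (0, 1) it equals μb by injectivity of Frobenius.
    obtain ⟨q, hq, hqp⟩ := exists_pow_root p (neg_mem (homCurve_map φ (P.toFun_homCurve hp0 hγ)))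
    refine ⟨p * d, _, add_mem (homCurve_comp_pow p hγ)
      (homCurve_map (LinearMap.toSpanSingleton K L b) hq), ?_, ?_, fun st hst => ?_⟩
    · have h := hqp (1, 0)
      simp only [Pi.neg_apply, one_pow, zero_pow hp0.ne', hγx, hφJ _ hx, neg_zero] at h
      have h0 : q (1, 0) = 0 := pow_eq_zero_iff hp0.ne' |>.mp h
      simp [hp0.ne', hγx, h0]
    · have h := hqp (0, 1)
      simp only [Pi.neg_apply, one_pow, zero_pow hp0.ne', hγw, ← hμ] at h
      simp [hp0.ne', hγw, hinj h]
    · have hst' : ((st.1 ^ p, st.2 ^ p) : K × K) ≠ 0 := by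
        simpa [Prod.ext_iff, hp0.ne'] using hst
      obtain ⟨h1, h2⟩ := hγJ _ hst'
      refine ⟨hcorr _ _ h1 (hqp st), fun h => h2 ?_⟩
      exact (Submodule.add_mem_iff_left _ (Submodule.smul_mem _ (q st) hbI')).mp
        (Submodule.mem_sup_left h)

end Correction

/-! ### Polynomial families of planes in the Grassmannian -/

section Planes

variable {K V : Type*} [Field K] [AddCommGroup V] [Module K V]

/-- The plane with basis `v, y`. -/
def plane (v y : V) (h : LinearIndependent K ![v, y]) : Gr₂ K V :=
  ⟨Submodule.span K (Set.range ![v, y]), by rw [finrank_span_eq_card h]; simp⟩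

theorem left_mem_plane {v y : V} (h : LinearIndependent K ![v, y]) : v ∈ (plane v y h).1 :=
  Submodule.subset_span ⟨0, rfl⟩

theorem right_mem_plane {v y : V} (h : LinearIndependent K ![v, y]) : y ∈ (plane v y h).1 :=
  Submodule.subset_span ⟨1, rfl⟩

theorem mem_plane_iff {v y : V} (h : LinearIndependent K ![v, y]) {x : V} :
    x ∈ (plane v y h).1 ↔ ∃ a b : K, a • v + b • y = x := by
  change x ∈ Submodule.span K (Set.range ![v, y]) ↔ _
  rw [Matrix.range_cons, Matrix.range_cons, Matrix.range_empty, Set.union_empty,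
    Set.singleton_union, Submodule.mem_span_pair]

theorem eq_plane {v y : V} (h : LinearIndependent K ![v, y]) {e : Gr₂ K V} (hv : v ∈ e.1)
    (hy : y ∈ e.1) : e = plane v y h := by
  have : Module.Finite K e.1 := Module.finite_of_finrank_eq_succ e.2
  refine (Subtype.ext (Submodule.eq_of_le_of_finrank_eq ?_ ?_)).symm
  · intro x hx
    obtain ⟨a, b, rfl⟩ := (mem_plane_iff h).mp hx
    exact add_mem (e.1.smul_mem a hv) (e.1.smul_mem b hy)
  · rw [e.2, (plane v y h).2]

theorem evalAt_polynomial {c : K → V}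
    (hc : ∀ φ : Module.Dual K V, ∃ Q : Polynomial K, ∀ t, φ (c t) = Q.eval t)
    (f : MvPolynomial (Module.Dual K V) K) :
    ∃ Q : Polynomial K, ∀ t, evalAt f (c t) = Q.eval t := by
  choose Q hQ using hc
  refine ⟨MvPolynomial.aeval Q f, fun t => ?_⟩
  unfold evalAt
  induction f using MvPolynomial.induction_on with
  | C a => simp
  | add f g hf hg => simp [hf, hg]
  | mul_X f φ hf => simp [hf, ← hQ]

theorem isPreconnected_univ_cofinite {X : Type*} [Infinite X] :
    IsPreconnected (Set.univ : Set (CofiniteTopology X)) := by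
  have : Infinite (CofiniteTopology X) := .of_injective _ CofiniteTopology.of.injective
  refine IsPreirreducible.isPreconnected ?_
  rintro U U' hU hU' ⟨x, -, hx⟩ ⟨x', -, hx'⟩
  have h1 := (CofiniteTopology.isOpen_iff'.mp hU).resolve_left (Set.nonempty_iff_ne_empty.mp ⟨x, hx⟩)
  have h2 := (CofiniteTopology.isOpen_iff'.mp hU').resolve_left
    (Set.nonempty_iff_ne_empty.mp ⟨x', hx'⟩)
  obtain ⟨y, hy⟩ := (h1.union h2).infinite_compl.nonempty
  exact ⟨y, trivial, by simpa using hy⟩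

/-- A family of planes spanned by a fixed vector and a polynomially varying one is connected. -/
theorem isPreconnected_range_plane [Infinite K] {v : V} {γ : K → V}
    (hγ : ∀ φ : Module.Dual K V, ∃ Q : Polynomial K, ∀ t, φ (γ t) = Q.eval t)
    (h : ∀ t, LinearIndependent K ![v, γ t]) :
    IsPreconnected (Set.range fun t => plane v (γ t) (h t)) := by
  -- The cofinite topology suffices: basic open sets pull back to nonvanishing loci of one-variable
  -- polynomials.
  let W : CofiniteTopology K → Gr₂ K V := fun t => plane v (γ (CofiniteTopology.of.symm t)) (h _)
  suffices hW : Continuous W by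
    have := isPreconnected_univ_cofinite.image W hW.continuousOn
    rw [Set.image_univ] at this
    exact CofiniteTopology.of.surjective.range_comp W ▸ this
  refine continuous_induced_rng.mpr (continuous_generateFrom_iff.mpr ?_)
  rintro U ⟨n, f, hf, rfl⟩
  -- With v fixed, y ↦ v ∧ y is linear, which keeps the Plücker vector polynomial in t.
  let ℓ : V →ₗ[K] ⋀[K]^2 V :=
    (exteriorPower.ιMulti K 2 (M := V)).toMultilinearMap.toLinearMap ![v, 0] 1
  have hℓ : ∀ y, ℓ y = exteriorPower.ιMulti K 2 ![v, y] := by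
    intro y
    change exteriorPower.ιMulti K 2 (Function.update ![v, 0] 1 y) = _
    congr 1
    ext i
    fin_cases i <;> simp
  obtain ⟨Q, hQ⟩ := evalAt_polynomial (c := fun t => ℓ (γ t)) (fun φ => hγ (φ ∘ₗ ℓ)) f
  have hpre : (plucker ∘ W) ⁻¹' basicOpen f = CofiniteTopology.of.symm ⁻¹' {t | Q.eval t ≠ 0} := by
    ext t
    have hmem : ∀ i, ![v, γ (CofiniteTopology.of.symm t)] i ∈ (W t).1 := by
      intro i
      fin_cases i
      · exact left_mem_plane (h _)
      · exact right_mem_plane (h _)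
    rw [Set.mem_preimage, Function.comp_apply, plucker_eq _ _ (h _) hmem, mk_mem_basicOpen hf,
      ← hℓ, hQ]
    rfl
  rw [hpre]
  refine CofiniteTopology.isOpen_iff'.mpr ?_
  by_cases hQ0 : Q = 0
  · left
    simp [hQ0]
  · right
    refine ((Polynomial.finite_setOfPred_isRoot hQ0).preimage
      CofiniteTopology.of.symm.injective.injOn).subset fun t ht => ?_
    simpa using ht

end Planes

/-! ### Linking points by connected subsets -/

section Linked

variable {X : Type*} [TopologicalSpace X]

/-- Two points are linked in `s` if they lie in a common connected subset of `s`. -/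
def Linked (s : Set X) (x y : X) : Prop :=
  ∃ t ⊆ s, x ∈ t ∧ y ∈ t ∧ IsPreconnected t

theorem Linked.refl {s : Set X} {x : X} (hx : x ∈ s) : Linked s x x :=
  ⟨{x}, by simpa using hx, rfl, rfl, isPreconnected_singleton⟩

theorem Linked.symm {s : Set X} {x y : X} (h : Linked s x y) : Linked s y x := by
  obtain ⟨t, ht, hx, hy, hc⟩ := h
  exact ⟨t, ht, hy, hx, hc⟩

theorem Linked.trans {s : Set X} {x y z : X} (h : Linked s x y) (h' : Linked s y z) :
    Linked s x z := by
  obtain ⟨t, ht, hx, hy, hc⟩ := h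
  obtain ⟨t', ht', hy', hz, hc'⟩ := h'
  exact ⟨t ∪ t', Set.union_subset ht ht', Or.inl hx, Or.inr hz, hc.union y hy hy' hc'⟩

end Linked

/-! ### Pencils of elementary abelian planes -/

section ElemAb

variable {K L : Type*} [Field K] [LieRing L] [LieAlgebra K L] {p : ℕ} {P : PMap p K L}

theorem plane_mem_elemAb₂ (hp : 3 ≤ p) {v y : L} (h : LinearIndependent K ![v, y])
    (hv : P.toFun v = 0) (hy : P.toFun y = 0) (hvy : ⁅v, y⁆ = 0) :
    plane v y h ∈ elemAb₂ P := by
  have hyv : ⁅y, v⁆ = 0 := by rw [← lie_skew, hvy, neg_zero]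
  constructor
  · intro x hx x' hx'
    obtain ⟨a, b, rfl⟩ := (mem_plane_iff h).mp hx
    obtain ⟨a', b', rfl⟩ := (mem_plane_iff h).mp hx'
    simp [hvy, hyv]
  · intro x hx
    obtain ⟨a, b, rfl⟩ := (mem_plane_iff h).mp hx
    have := P.toFun_add_sub_mem hp (J := ⊥) (x := a • v) (y := b • y) (by simp) (by simp [hvy])
      (by simp [hvy])
    simpa [P.toFun_smul, hv, hy] using this

/-- The end points of a homogeneous curve of planes in `𝔼(2, L)` through a fixed vector are
linked. -/
theorem linked_of_homCurve [Infinite K] (hp : 3 ≤ p) {v : L} {d : ℕ} {γ : K × K → L}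
    (hγ : γ ∈ homCurve K L d) (hv : P.toFun v = 0) (hli : ∀ st ≠ 0, LinearIndependent K ![v, γ st])
    (hvγ : ∀ st ≠ 0, ⁅v, γ st⁆ = 0) (hPγ : ∀ st ≠ 0, P.toFun (γ st) = 0) :
    Linked (elemAb₂ P) (plane v (γ (1, 0)) (hli _ (by simp)))
      (plane v (γ (0, 1)) (hli _ (by simp))) := by
  -- The chart (1, t) misses (0, 1), so both end points are linked to (1, 1), the second through the
  -- swapped curve.
  have key : ∀ δ ∈ homCurve K L d, (∀ st ≠ 0, ∃ st' ≠ 0, δ st = γ st') →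
      ∀ h0 : LinearIndependent K ![v, δ (1, 0)], ∀ h1 : LinearIndependent K ![v, δ (1, 1)],
      Linked (elemAb₂ P) (plane v (δ (1, 0)) h0) (plane v (δ (1, 1)) h1) := by
    intro δ hδ hδγ h0 h1
    have hne : ∀ t : K, ((1, t) : K × K) ≠ 0 := fun t => by simp
    have hli' : ∀ t : K, LinearIndependent K ![v, δ (1, t)] := fun t => by
      obtain ⟨st, hst, h⟩ := hδγ _ (hne t)
      rw [h]
      exact hli _ hst
    refine ⟨Set.range fun t => plane v (δ (1, t)) (hli' t), ?_, ⟨0, rfl⟩, ⟨1, rfl⟩,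
      isPreconnected_range_plane (γ := fun t => δ (1, t))
        (fun φ => homCurve_eval_left (homCurve_map φ hδ)) hli'⟩
    rintro _ ⟨t, rfl⟩
    obtain ⟨st, hst, h⟩ := hδγ _ (hne t)
    refine plane_mem_elemAb₂ hp _ hv ?_ ?_
    · rw [h]; exact hPγ _ hst
    · rw [h]; exact hvγ _ hst
  have hne : ((1, 1) : K × K) ≠ 0 := by simp
  exact (key γ hγ (fun st h => ⟨st, h, rfl⟩) _ (hli _ hne)).trans
    (key _ (homCurve_comp_swap hγ)
      (fun st h => ⟨st.swap, fun h' => h (by simpa using congrArg Prod.swap h'), rfl⟩)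
      (hli (0, 1) (by simp)) (hli _ hne)).symm

/-- Every plane in `𝔼(2, L)` is linked to one that contains a given central element `z` with
`z^[p] = 0`. -/
theorem exists_linked_mem [Infinite K] (hp : 3 ≤ p) {z : L} (hzc : ∀ x : L, ⁅x, z⁆ = 0)
    (hzp : P.toFun z = 0) {e : Gr₂ K L} (he : e ∈ elemAb₂ P) :
    ∃ e' ∈ elemAb₂ P, z ∈ e'.1 ∧ Linked (elemAb₂ P) e e' := by
  by_cases hz : z ∈ e.1
  · exact ⟨e, he, hz, .refl he⟩
  set v : L := (e.basis 0 : L)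
  set y : L := (e.basis 1 : L)
  have hv : v ∈ e.1 := (e.basis 0).2
  have hy : y ∈ e.1 := (e.basis 1).2
  have hvy : LinearIndependent K ![v, y] := by
    convert e.basis_linearIndependent using 1
    ext i
    fin_cases i <;> rfl
  have hli : ∀ st : K × K, st ≠ 0 → LinearIndependent K ![v, st.1 • y + st.2 • z] := by
    intro st hst
    rw [LinearIndependent.pair_iff]
    intro a c hac
    have h1 : (c * st.2) • z ∈ e.1 := by
      have : (c * st.2) • z = -(a • v + (c * st.1) • y) := by
        rw [eq_neg_iff_add_eq_zero, ← hac]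
        module
      rw [this]
      exact neg_mem (add_mem (e.1.smul_mem _ hv) (e.1.smul_mem _ hy))
    have h2 : c * st.2 = 0 := by
      by_contra h
      exact hz ((Submodule.smul_mem_iff _ h).mp h1)
    have h3 := LinearIndependent.pair_iff.mp hvy a (c * st.1) (by
      rw [← hac, smul_add, smul_smul, smul_smul, h2, zero_smul, add_zero])
    refine ⟨h3.1, ?_⟩
    by_contra hc
    exact hst (Prod.ext ((mul_eq_zero.mp h3.2).resolve_left hc)
      ((mul_eq_zero.mp h2).resolve_left hc))
  have hPy : ∀ s t : K, P.toFun (s • y + t • z) = 0 := by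
    intro s t
    have := P.toFun_add_sub_mem hp (J := ⊥) (x := s • y) (y := t • z) (by simp) (by simp [hzc])
      (by simp [hzc])
    simpa [P.toFun_smul, hzp, he.2 y hy] using this
  have hvz : LinearIndependent K ![v, z] := by simpa using hli (0, 1) (by simp)
  refine ⟨plane v z hvz, plane_mem_elemAb₂ hp _ (he.2 v hv) hzp (hzc v), right_mem_plane hvz, ?_⟩
  have := linked_of_homCurve (P := P) hp (linear_mem_homCurve y z) (he.2 v hv) hli
    (fun st _ => by simp [hzc, he.1 v hv y hy]) (fun st _ => hPy _ _)
  rw [eq_plane hvy hv hy]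
  simpa using this

end ElemAb

end RestrictedLie

end

/-! ### Connectedness of 𝔼(2, u) -/

open RestrictedLie in
theorem theoremA {K : Type*} [Field K] [IsAlgClosed K] (p : ℕ) [CharP K p] (hp : 3 ≤ p)
    {u : Type*} [LieRing u] [LieAlgebra K u] [FiniteDimensional K u]
    (P : RestrictedLie.PMap p K u) (hP : P.IsUnipotent) :
    IsPreconnected (RestrictedLie.elemAb₂ P) := by
  have hinf : Infinite K := IsAlgClosed.instInfinite
  refine isPreconnected_of_forall_pair fun e he e' he' => ?_
  change Linked _ e e'
  have htop : (⊥ : Submodule K u) ≠ ⊤ := by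
    intro h
    have h2 := e.2
    rw [eq_bot_iff.mpr (h ▸ le_top : e.1 ≤ ⊥), finrank_bot] at h2
    omega
  obtain ⟨z, hz, hzc, hzp⟩ := P.exists_central_mod (by omega) hP htop
  simp only [Submodule.mem_bot] at hz hzc hzp
  have hli : ∀ y, LinearIndependent K ![z, y] ↔ y ∉ Submodule.span K {z} := fun y => by
    rw [LinearIndependent.pair_iff' hz, Submodule.mem_span_singleton, not_exists]
  have hzl : ∀ x : u, ⁅z, x⁆ = 0 := fun x => by rw [← lie_skew, hzc, neg_zero]
  obtain ⟨φ, hφz, -⟩ := Submodule.exists_le_ker_of_notMem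
    (show z ∉ (⊥ : Submodule K u) by simpa using hz)
  obtain ⟨w, hw, H⟩ := P.exists_curves hp hP (Submodule.span K {z}) ⊥ φ bot_le (by simp)
    (by
      intro v hv hv0
      obtain ⟨a, rfl⟩ := Submodule.mem_span_singleton.mp hv
      rw [map_smul, smul_eq_mul] at hv0
      simp [(mul_eq_zero.mp hv0).resolve_right hφz])
    (by simp)
    (by
      intro x y hy
      obtain ⟨a, rfl⟩ := Submodule.mem_span_singleton.mp hy
      simp [hzc])
    (by
      intro y hy
      obtain ⟨a, rfl⟩ := Submodule.mem_span_singleton.mp hy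
      simp [P.toFun_smul, hzp])
  simp only [Submodule.mem_bot] at hw H
  -- That w ∉ Kz is part of the claim: it is deduced from the existence of e.
  have hcenter : ∀ e ∈ elemAb₂ P, ∃ h : LinearIndependent K ![z, w],
      Linked (elemAb₂ P) e (plane z w h) := by
    intro e he
    obtain ⟨e₁, he₁, hze₁, hl⟩ := exists_linked_mem hp hzc hzp he
    obtain ⟨x, hx, hxz⟩ : ∃ x ∈ e₁.1, x ∉ Submodule.span K {z} := by
      rw [← SetLike.not_le_iff_exists]
      intro hle
      have h := Submodule.finrank_mono hle
      rw [e₁.2, finrank_span_singleton hz] at h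
      omega
    have hzx := (hli x).mpr hxz
    rcases H x (he₁.2 x hx) hxz with hmem | ⟨d, γ, hγ, hγx, hγw, hγE⟩
    · obtain ⟨i, hi, a, rfl⟩ := mem_sup_span_singleton.mp hmem
      have ha : a ≠ 0 := by
        rintro rfl
        exact hxz (by simpa using hi)
      have hwz : w ∉ Submodule.span K {z} := fun h =>
        hxz (add_mem hi (Submodule.smul_mem _ a h))
      have hie : i ∈ e₁.1 := (Submodule.span_singleton_le_iff_mem z e₁.1).mpr hze₁ hi
      have hwe : w ∈ e₁.1 :=
        (Submodule.smul_mem_iff _ ha).mp ((Submodule.add_mem_iff_right _ hie).mp hx)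
      refine ⟨(hli w).mpr hwz, ?_⟩
      rwa [← eq_plane ((hli w).mpr hwz) hze₁ hwe]
    · subst hγx hγw
      refine ⟨(hli _).mpr (hγE (0, 1) (by simp)).2, hl.trans ?_⟩
      rw [eq_plane hzx hze₁ hx]
      exact linked_of_homCurve hp hγ hzp (fun st hst => (hli _).mpr (hγE st hst).2)
        (fun st _ => hzl _) (fun st hst => (hγE st hst).1)
  obtain ⟨h, hl⟩ := hcenter e he
  obtain ⟨_, hl'⟩ := hcenter e' he'
  exact hl.trans hl'.symm
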